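/- Let $d\ge 1$ and $0\le L\le k$ be integers. Consider a directed graph with a signal edge $(u,v)$, $u\ne v$, and $k$ further pairwise distinct (nuisance) edges: $L$ edges $(u,p_1),\dots,(u,p_L)$ sharing the source vertex $u$ with the signal edge, and $k-L$ edges $(q_1,r_1),\dots,(q_{k-L},r_{k-L})$, where all $p_i,q_j,r_j$ are different from $u$ and $v$. The vertices $p_i,q_j,r_j$ may otherwise coincide, except that the edges $(q_j,r_j)$ contain no loop and no pair of mutually reversed edges. (In particular all vertices may be distinct.) Assign to the vertices independent random codes, each uniformly distributed on the unit sphere $\mathbb S^{d-1}\subset\mathbb R^d$, and denote the code of a vertex by the same letter. Let $$G=uv^T+\sum_{i=1}^{L}u\,p_i^T+\sum_{j=1}^{k-L}q_j r_j^T,\qquad T=u^T G\,v,\qquad \sigma^2=\frac{L}{d}+\frac{k-L}{d^2},\quad \sigma\ge 0 .$$ Then: 1. $T$ is square integrable and $\mathbb E\,T=1$. 2. $\operatorname{Var}(T)=\sigma^2$. 3. $|T-1|=O(\sigma)$ with high probability: for every $\delta>0$ there is a constant $C>0$ depending only on $\delta$ such that $\mathbb P(|T-1|\le C\sigma)\ge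 1-\delta$ for all $d,k,L$ and all such graphs. If, moreover, all the vertices $u,v,p_i,q_j,r_j$ are distinct, then for every $C>0$ $$\mathbb P\big(|T-1|>C\sigma\big)\le 2\exp\!\left(-\frac{C^2\sigma^2}{2\,(\sigma^2+C\sigma/3)}\right),$$ where the exponent is read as $0$ when $\sigma=0$. 4. When $k$ is large compared with $L$, $|T-1|=O(\sqrt k/d)$ with high probability: for all $A,\delta>0$ there is a constant $C>0$ depending only on $A$ and $\delta$ such that $\mathbb P(|T-1|\le C\sqrt k/d)\ge 1-\delta$ for all $d,k,L$ with $dL\le Ak$ and all such graphs. (For fixed $d$ and $A=1$ the condition is $k\ge dL$.) -/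

import Mathlib

open MeasureTheory ProbabilityTheory
open scoped Matrix

noncomputable section

/-- Real `d`-dimensional Euclidean space. -/
abbrev Euc (d : ℕ) : Type := EuclideanSpace ℝ (Fin d)

/-- The unit sphere `S^(d-1)` of `Euc d`. -/
abbrev UnitSphere (d : ℕ) : Type := Metric.sphere (0 : Euc d) 1

/-- The uniform distribution on the unit sphere: surface measure, normalized to total mass one. -/
def sphereUniform (d : ℕ) : Measure (UnitSphere d) :=
  ((volume : Measure (Euc d)).toSphere Set.univ)⁻¹ • (volume : Measure (Euc d)).toSphere

/-- A random spherical vertex code on the vertex set `V`: the codes of the vertices are independent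
and each of them is uniformly distributed on the unit sphere. -/
structure IsSphericalCode {Ω V : Type*} [MeasurableSpace Ω] {d : ℕ}
    (x : V → Ω → UnitSphere d) (μ : Measure Ω) : Prop where
  measurable : ∀ a, Measurable (x a)
  indep : iIndepFun x μ
  law : ∀ a, μ.map (x a) = sphereUniform d

/-- A directed graph with a signal edge `(u, v)` and `k` nuisance edges, `L` of which are edges
`(u, p i)` that share the source vertex with the signal edge, while the other `k - L` edges
`(q j, r j)` do not touch the signal edge. Edges are listed without repetition. The edges
`(q j, r j)` may share vertices with each other and with the edges `(u, p i)`, but they contain no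
loop and no pair of mutually reversed edges (both are excluded by `oriented`, loops by `j = j'`). -/
structure QueryGraph (V : Type*) (k L : ℕ) where
  u : V
  v : V
  p : Fin L → V
  q : Fin (k - L) → V
  r : Fin (k - L) → V
  L_le : L ≤ k
  u_ne_v : u ≠ v
  p_ne : ∀ i, p i ≠ u ∧ p i ≠ v
  q_ne : ∀ j, q j ≠ u ∧ q j ≠ v
  r_ne : ∀ j, r j ≠ u ∧ r j ≠ v
  p_injective : Function.Injective p
  edge_injective : Function.Injective fun j => (q j, r j)
  oriented : ∀ j j', (q j, r j) ≠ (r j', q j')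

namespace QueryGraph

variable {V : Type*} {k L : ℕ}

/-- All the vertices occurring in the graph are different (`u` and `v` are different from each
other and from the remaining ones in every `QueryGraph`). -/
def VerticesDistinct (g : QueryGraph V k L) : Prop :=
  Function.Injective (Sum.elim g.p (Sum.elim g.q g.r))

/-- The tensor embedding `a bᵀ` of the directed edge `(a, b)` under the vertex code `y`. -/
def edgeEmbedding {d : ℕ} (y : V → UnitSphere d) (a b : V) : Matrix (Fin d) (Fin d) ℝ :=
  Matrix.vecMulVec (y a : Euc d).ofLp (y b : Euc d).ofLp

/-- The embedding `u vᵀ + ∑ i, u (p i)ᵀ + ∑ j, (q j) (r j)ᵀ` of the graph under the vertex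
code `y`: the sum of the embeddings of its edges. -/
def embedding (g : QueryGraph V k L) {d : ℕ} (y : V → UnitSphere d) :
    Matrix (Fin d) (Fin d) ℝ :=
  edgeEmbedding y g.u g.v + ∑ i, edgeEmbedding y g.u (g.p i)
    + ∑ j, edgeEmbedding y (g.q j) (g.r j)

/-- The edge query `aᵀ M b` of the edge `(a, b)` in the matrix `M`. -/
def edgeQuery {d : ℕ} (y : V → UnitSphere d) (M : Matrix (Fin d) (Fin d) ℝ) (a b : V) : ℝ :=
  (y a : Euc d).ofLp ⬝ᵥ (M *ᵥ (y b : Euc d).ofLp)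

/-- The query score `T = uᵀ G v` of the signal edge, as a random variable. -/
def trueScore (g : QueryGraph V k L) {d : ℕ} {Ω : Type*} (x : V → Ω → UnitSphere d) (ω : Ω) : ℝ :=
  edgeQuery (fun a => x a ω) (g.embedding fun a => x a ω) g.u g.v

end QueryGraph

/-- The quantity `σ² = L / d + (k - L) / d²`. -/
def querySigmaSq (d k L : ℕ) : ℝ := (L : ℝ) / d + ((k : ℝ) - L) / (d : ℝ) ^ 2

/-- The quantity `σ`. -/
def querySigma (d k L : ℕ) : ℝ := √(querySigmaSq d k L)

end

/-! Since codes have norm one, bilinearity gives `T = 1 + ∑ ⟨v, p_i⟩ + ∑ ⟨u, q_j⟩⟨v, r_j⟩`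
(`trueScore_eq`). The codes of `u` and `v` are independent of all the others, so they may be frozen
and integrated last (`integral_noiseTerm_eq_integral_integral`). The uniform law on the sphere is
centred with covariance `I/d`, so for every frozen pair each noise term has mean `0` and second
moment `1/d` or `1/d²`.

Different noise terms are orthogonal even when edges share vertices: some vertex code can be negated
so that their product changes sign, while the joint law is unchanged (`integral_noise_mul_noise`).
Hence the variance is `σ²`, and Chebyshev yields both high-probability bounds.

If all vertices are distinct, the noise terms with `u` and `v` frozen are independent and bounded by
one. Bernstein's moment generating function bound then depends on the frozen codes only through
variances, which are constant, so it survives integration over `u` and `v` (`mgf_sum_noise_le`). -/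

noncomputable section

/-! ### Isometry invariance and second moments of the uniform law on the sphere -/

/-- The action of a linear isometry on the unit sphere. -/
def sphereMap {d : ℕ} (e : Euc d ≃ₗᵢ[ℝ] Euc d) (y : UnitSphere d) : UnitSphere d :=
  ⟨e y, by simp⟩

lemma coe_sphereMap {d : ℕ} (e : Euc d ≃ₗᵢ[ℝ] Euc d) (y : UnitSphere d) :
    (sphereMap e y : Euc d) = e y := rfl

lemma measurable_sphereMap {d : ℕ} (e : Euc d ≃ₗᵢ[ℝ] Euc d) : Measurable (sphereMap e) :=
  (e.continuous.measurable.comp measurable_subtype_coe).subtype_mk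

-- `toSphere` measures a set through the volume of the cone over it; a linear isometry carries cones
-- to cones and preserves volume.
open scoped Pointwise in
lemma measurePreserving_sphereMap_toSphere {d : ℕ} (e : Euc d ≃ₗᵢ[ℝ] Euc d) :
    MeasurePreserving (sphereMap e) (volume : Measure (Euc d)).toSphere
      (volume : Measure (Euc d)).toSphere := by
  refine ⟨measurable_sphereMap e, ?_⟩
  ext s hs
  rw [Measure.map_apply (measurable_sphereMap e) hs, Measure.toSphere_apply' _ hs,
    Measure.toSphere_apply' _ (measurable_sphereMap e hs)]
  congr 1
  conv_rhs => rw [← e.measurePreserving.measure_preimage_equiv (f := e.toMeasurableEquiv)]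
  congr 1
  ext z
  simp only [Set.mem_smul, Set.mem_image, Set.mem_preimage]
  constructor
  · rintro ⟨c, hc, _, ⟨y, hy, rfl⟩, rfl⟩
    exact ⟨c, hc, _, ⟨sphereMap e y, hy, rfl⟩, (map_smul e c (y : Euc d)).symm⟩
  · rintro ⟨c, hc, _, ⟨y, hy, rfl⟩, h⟩
    refine ⟨c, hc, _, ⟨sphereMap e.symm y, ?_, rfl⟩, ?_⟩
    · have : sphereMap e (sphereMap e.symm y) = y := by
        ext1; simp [coe_sphereMap]
      rwa [this]
    · apply e.injective
      rw [map_smul, coe_sphereMap, e.apply_symm_apply]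
      exact h

lemma measurePreserving_sphereMap {d : ℕ} (e : Euc d ≃ₗᵢ[ℝ] Euc d) :
    MeasurePreserving (sphereMap e) (sphereUniform d) (sphereUniform d) :=
  (measurePreserving_sphereMap_toSphere e).smul_measure _

lemma isProbabilityMeasure_sphereUniform {d : ℕ} (hd : 1 ≤ d) :
    IsProbabilityMeasure (sphereUniform d) := by
  have : Nonempty (Fin d) := ⟨⟨0, hd⟩⟩
  refine ⟨?_⟩
  rw [sphereUniform, Measure.smul_apply, smul_eq_mul]
  refine ENNReal.inv_mul_cancel ?_ (measure_ne_top _ _)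
  rw [ne_eq, Measure.measure_univ_eq_zero]
  exact Measure.toSphere_ne_zero _

lemma integral_sphereMap {d : ℕ} (e : Euc d ≃ₗᵢ[ℝ] Euc d) {f : UnitSphere d → ℝ}
    (hf : Measurable f) :
    ∫ y, f (sphereMap e y) ∂sphereUniform d = ∫ y, f y ∂sphereUniform d := by
  conv_rhs => rw [← (measurePreserving_sphereMap e).map_eq]
  exact (integral_map (measurable_sphereMap e).aemeasurable hf.aestronglyMeasurable).symm

lemma abs_apply_le_one {d : ℕ} (y : UnitSphere d) (i : Fin d) : |(y : Euc d) i| ≤ 1 := by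
  have := PiLp.norm_apply_le (y : Euc d) i
  simpa using this

lemma integrable_of_measurable_of_abs_le {α : Type*} [MeasurableSpace α] {μ : Measure α}
    [IsFiniteMeasure μ] {f : α → ℝ} (hf : Measurable f) {C : ℝ} (h : ∀ a, |f a| ≤ C) :
    Integrable f μ :=
  Integrable.of_bound hf.aestronglyMeasurable C (.of_forall h)

lemma integral_inner_sphereUniform {d : ℕ} (a : Euc d) :
    ∫ y, inner ℝ a (y : Euc d) ∂sphereUniform d = 0 := by
  have h := integral_sphereMap (LinearIsometryEquiv.neg ℝ : Euc d ≃ₗᵢ[ℝ] Euc d)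
    (f := fun y => inner ℝ a (y : Euc d)) (by fun_prop)
  simp only [coe_sphereMap, LinearIsometryEquiv.coe_neg, inner_neg_right, integral_neg] at h
  linarith

/-- Reflecting the `i`-th coordinate changes the sign of the integrand. -/
lemma integral_coord_mul_coord_of_ne {d : ℕ} {i j : Fin d} (hij : i ≠ j) :
    ∫ y, (y : Euc d) i * (y : Euc d) j ∂sphereUniform d = 0 := by
  have h := integral_sphereMap (LinearIsometryEquiv.piLpCongrRight 2
      (fun l => if l = i then LinearIsometryEquiv.neg ℝ else LinearIsometryEquiv.refl ℝ ℝ) :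
      Euc d ≃ₗᵢ[ℝ] Euc d)
    (f := fun y => (y : Euc d) i * (y : Euc d) j) (by fun_prop)
  simp [coe_sphereMap, hij.symm, integral_neg] at h
  linarith

/-- Coordinate swaps make the `d` second moments equal, and they add up to `‖y‖² = 1`. -/
lemma integral_coord_sq {d : ℕ} (hd : 1 ≤ d) (i : Fin d) :
    ∫ y, (y : Euc d) i * (y : Euc d) i ∂sphereUniform d = 1 / d := by
  have := isProbabilityMeasure_sphereUniform hd
  have heq (j : Fin d) : ∫ y, (y : Euc d) j * (y : Euc d) j ∂sphereUniform d =
      ∫ y, (y : Euc d) i * (y : Euc d) i ∂sphereUniform d := by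
    have h := integral_sphereMap (LinearIsometryEquiv.piLpCongrLeft 2 ℝ ℝ (Equiv.swap i j) :
        Euc d ≃ₗᵢ[ℝ] Euc d)
      (f := fun y => (y : Euc d) i * (y : Euc d) i) (by fun_prop)
    simpa [coe_sphereMap, LinearIsometryEquiv.piLpCongrLeft_apply, Equiv.piCongrLeft'] using h
  have hsum : ∑ j : Fin d, ∫ y, (y : Euc d) j * (y : Euc d) j ∂sphereUniform d = 1 := by
    rw [← integral_finsetSum]
    · have (y : UnitSphere d) : ∑ j, (y : Euc d) j * (y : Euc d) j = 1 := by
        have := EuclideanSpace.real_norm_sq_eq (y : Euc d)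
        simp only [norm_eq_of_mem_sphere] at this
        simpa [pow_two] using this.symm
      simp [this]
    · refine fun j _ => integrable_of_measurable_of_abs_le (by fun_prop) (C := 1) fun y => ?_
      rw [abs_mul]
      exact mul_le_one₀ (abs_apply_le_one y j) (abs_nonneg _) (abs_apply_le_one y j)
  simp only [heq, Finset.sum_const, Finset.card_univ, Fintype.card_fin, nsmul_eq_mul] at hsum
  have : (d : ℝ) ≠ 0 := by positivity
  rw [eq_div_iff this, mul_comm]
  exact hsum

lemma integral_inner_sq_sphereUniform {d : ℕ} (hd : 1 ≤ d) (a : Euc d) :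
    ∫ y, inner ℝ a (y : Euc d) ^ 2 ∂sphereUniform d = ‖a‖ ^ 2 / d := by
  have := isProbabilityMeasure_sphereUniform hd
  have hexp (y : UnitSphere d) : inner ℝ a (y : Euc d) ^ 2 =
      ∑ i, ∑ j, a i * a j * ((y : Euc d) i * (y : Euc d) j) := by
    rw [PiLp.inner_apply, pow_two, Finset.sum_mul_sum]
    refine Finset.sum_congr rfl fun i _ => Finset.sum_congr rfl fun j _ => ?_
    simp only [RCLike.inner_apply, conj_trivial]
    ring
  have hint (i j : Fin d) : Integrable
      (fun y : UnitSphere d => a i * a j * ((y : Euc d) i * (y : Euc d) j)) (sphereUniform d) := by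
    refine (integrable_of_measurable_of_abs_le (by fun_prop) (C := 1) fun y => ?_).const_mul _
    rw [abs_mul]
    exact mul_le_one₀ (abs_apply_le_one y i) (abs_nonneg _) (abs_apply_le_one y j)
  simp_rw [hexp]
  rw [integral_finsetSum _ fun i _ => integrable_finsetSum _ fun j _ => hint i j]
  rw [EuclideanSpace.real_norm_sq_eq, Finset.sum_div]
  refine Finset.sum_congr rfl fun i _ => ?_
  rw [integral_finsetSum _ fun j _ => hint i j, Finset.sum_eq_single i]
  · rw [integral_const_mul, integral_coord_sq hd]
    ring
  · intro j _ hj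
    rw [integral_const_mul, integral_coord_mul_coord_of_ne hj.symm, mul_zero]
  · simp

/-! ### Independence: grouping into blocks and Fubini -/

/-- Independence means that the joint law is a product measure, and a product over a sigma type is a
product of products. This is what later groups vertex codes by nuisance edge. -/
lemma iIndepFun_curry {Ω ι : Type*} [MeasurableSpace Ω] {P : Measure Ω} {κ : ι → Type*}
    {𝓧 : (i : ι) → κ i → Type*} [∀ i j, MeasurableSpace (𝓧 i j)]
    {X : (i : ι) → (j : κ i) → Ω → 𝓧 i j} (mX : ∀ i j, Measurable (X i j))
    (h : iIndepFun (fun (p : (i : ι) × κ i) ω => X p.1 p.2 ω) P) :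
    iIndepFun (fun i ω => (X i · ω)) P := by
  have := h.isProbabilityMeasure
  have : ∀ i j, IsProbabilityMeasure (P.map (X i j)) :=
    fun i j => Measure.isProbabilityMeasure_map (mX i j).aemeasurable
  have hcomp : (MeasurableEquiv.piCurry 𝓧) ∘ (fun ω p => X p.1 p.2 ω) = fun ω i j => X i j ω := by
    ext; simp [Sigma.curry]
  rw [iIndepFun_iff_map_fun_eq_infinitePi_map (by fun_prop), ← hcomp,
    ← Measure.map_map (by fun_prop) (by fun_prop),
    (iIndepFun_iff_map_fun_eq_infinitePi_map (by fun_prop)).1 h,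
    Measure.infinitePi_map_piCurry (fun i j => P.map (X i j))]
  congrm Measure.infinitePi fun i => ?_
  rw [(iIndepFun_iff_map_fun_eq_infinitePi_map (by fun_prop)).1
    (h.precomp (g := fun j : κ i => (⟨i, j⟩ : (i : ι) × κ i)) sigma_mk_injective)]

lemma IndepFun.integral_comp_prodMk {Ω α β : Type*} [MeasurableSpace Ω] [MeasurableSpace α]
    [MeasurableSpace β] {μ : Measure Ω} [IsProbabilityMeasure μ] {X : Ω → α} {Y : Ω → β}
    (h : IndepFun X Y μ) (hX : Measurable X) (hY : Measurable Y) {G : α × β → ℝ}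
    (hG : Measurable G) {C : ℝ} (hC : ∀ z, |G z| ≤ C) :
    ∫ ω, G (X ω, Y ω) ∂μ = ∫ ω, ∫ ω', G (X ω, Y ω') ∂μ ∂μ := by
  have := Measure.isProbabilityMeasure_map (μ := μ) hX.aemeasurable
  have := Measure.isProbabilityMeasure_map (μ := μ) hY.aemeasurable
  rw [← integral_map (f := G) (hX.prodMk hY).aemeasurable hG.aestronglyMeasurable,
    h.map_prod_eq_prod_map_map hX.aemeasurable hY.aemeasurable,
    integral_prod _ (integrable_of_measurable_of_abs_le hG hC),
    integral_map hX.aemeasurable (hG.stronglyMeasurable.integral_prod_right').aestronglyMeasurable]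
  refine integral_congr_ae (.of_forall fun ω => ?_)
  exact integral_map hY.aemeasurable (hG.comp measurable_prodMk_left).aestronglyMeasurable

/-! ### Symmetry and moments of spherical codes -/

namespace IsSphericalCode

variable {Ω V : Type*} [MeasurableSpace Ω] {d : ℕ} {x : V → Ω → UnitSphere d} {μ : Measure Ω}

lemma measurable_pi (h : IsSphericalCode x μ) : Measurable fun ω a => x a ω :=
  _root_.measurable_pi_iff.2 h.measurable

lemma map_eq (h : IsSphericalCode x μ) :
    μ.map (fun ω a => x a ω) = Measure.infinitePi fun _ : V => sphereUniform d := by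
  have := h.indep.isProbabilityMeasure
  rw [(iIndepFun_iff_map_fun_eq_infinitePi_map h.measurable).1 h.indep]
  simp_rw [h.law]

/-- The law of a spherical code is invariant under negating the code of one vertex. -/
lemma flip [DecidableEq V] (h : IsSphericalCode x μ) (a : V) :
    IsSphericalCode (fun b ω => if b = a then -x b ω else x b ω) μ := by
  have hneg : Measurable (Neg.neg : UnitSphere d → UnitSphere d) :=
    continuous_neg.measurable
  have hm (b : V) : Measurable fun y : UnitSphere d => if b = a then -y else y := by
    split_ifs
    · exact hneg
    · exact measurable_id
  refine ⟨fun b => (hm b).comp (h.measurable b), h.indep.comp _ hm, fun b => ?_⟩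
  have : (sphereMap (LinearIsometryEquiv.neg ℝ) : UnitSphere d → UnitSphere d) = Neg.neg := by
    ext1 y; ext1; simp [coe_sphereMap]
  split_ifs with hb
  · change μ.map (Neg.neg ∘ x b) = _
    rw [← Measure.map_map hneg (h.measurable b), h.law, ← this]
    exact (measurePreserving_sphereMap _).map_eq
  · exact h.law b

lemma integral_eq_zero_of_odd [DecidableEq V] (h : IsSphericalCode x μ) (a : V)
    {f : (V → UnitSphere d) → ℝ} (hf : Measurable f)
    (hodd : ∀ y, f (fun b => if b = a then -y b else y b) = -f y) :
    ∫ ω, f (fun b => x b ω) ∂μ = 0 := by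
  have h1 := integral_map (μ := μ) (f := f) h.measurable_pi.aemeasurable hf.aestronglyMeasurable
  have h2 := integral_map (μ := μ) (f := f) (h.flip a).measurable_pi.aemeasurable hf.aestronglyMeasurable
  rw [(h.flip a).map_eq, ← h.map_eq, h1] at h2
  simp only [hodd, integral_neg] at h2
  linarith

lemma integral_comp (h : IsSphericalCode x μ) (a : V) {f : UnitSphere d → ℝ} (hf : Measurable f) :
    ∫ ω, f (x a ω) ∂μ = ∫ y, f y ∂sphereUniform d := by
  rw [← h.law a, integral_map (h.measurable a).aemeasurable hf.aestronglyMeasurable]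

lemma integral_inner (h : IsSphericalCode x μ) (a : V) (w : Euc d) :
    ∫ ω, inner ℝ w (x a ω : Euc d) ∂μ = 0 := by
  rw [h.integral_comp a (f := fun y => inner ℝ w (y : Euc d)) (by fun_prop),
    integral_inner_sphereUniform]

lemma integral_inner_sq (h : IsSphericalCode x μ) (hd : 1 ≤ d) (a : V) (w : UnitSphere d) :
    ∫ ω, inner ℝ (w : Euc d) (x a ω : Euc d) ^ 2 ∂μ = 1 / d := by
  rw [h.integral_comp a (f := fun y => inner ℝ (w : Euc d) (y : Euc d) ^ 2) (by fun_prop),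
    integral_inner_sq_sphereUniform hd]
  simp

end IsSphericalCode

lemma abs_inner_sphere_le_one {d : ℕ} (y z : UnitSphere d) :
    |inner ℝ (y : Euc d) (z : Euc d)| ≤ 1 := by
  simpa using abs_real_inner_le_norm (y : Euc d) (z : Euc d)

/-! ### The score as signal plus noise -/

namespace QueryGraph

variable {V : Type*} {k L d : ℕ}

/-- The contribution of a nuisance edge to the query score, for given codes `a` and `b` of the
source and the target of the signal edge. -/
def noiseTerm (g : QueryGraph V k L) (a b : UnitSphere d) (y : V → UnitSphere d) :
    Fin L ⊕ Fin (k - L) → ℝ :=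
  Sum.elim (fun i => inner ℝ (b : Euc d) (y (g.p i) : Euc d))
    (fun j => inner ℝ (a : Euc d) (y (g.q j) : Euc d) * inner ℝ (b : Euc d) (y (g.r j) : Euc d))

lemma edgeQuery_edgeEmbedding (y : V → UnitSphere d) (a b a' b' : V) :
    edgeQuery y (edgeEmbedding y a' b') a b =
      inner ℝ (y a : Euc d) (y a' : Euc d) * inner ℝ (y b : Euc d) (y b' : Euc d) := by
  simp only [edgeQuery, edgeEmbedding, Matrix.vecMulVec_mulVec, EuclideanSpace.inner_eq_star_dotProduct,
    star_trivial, dotProduct_smul]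
  rw [dotProduct_comm (y a' : Euc d).ofLp]
  simp

lemma edgeQuery_add (y : V → UnitSphere d) (M N : Matrix (Fin d) (Fin d) ℝ) (a b : V) :
    edgeQuery y (M + N) a b = edgeQuery y M a b + edgeQuery y N a b := by
  simp [edgeQuery, Matrix.add_mulVec, dotProduct_add]

lemma edgeQuery_sum {ι : Type*} (s : Finset ι) (y : V → UnitSphere d)
    (M : ι → Matrix (Fin d) (Fin d) ℝ) (a b : V) :
    edgeQuery y (∑ i ∈ s, M i) a b = ∑ i ∈ s, edgeQuery y (M i) a b := by
  simp [edgeQuery, Matrix.sum_mulVec, dotProduct_sum]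

/-- The signal edge contributes `⟨u, u⟩⟨v, v⟩ = 1`, and an edge out of `u` loses its factor `⟨u, u⟩
= 1`; this is why its variance is `1/d` rather than `1/d²`. -/
lemma trueScore_eq (g : QueryGraph V k L) {Ω : Type*} (x : V → Ω → UnitSphere d) (ω : Ω) :
    g.trueScore x ω = 1 + ∑ e, g.noiseTerm (x g.u ω) (x g.v ω) (fun a => x a ω) e := by
  simp only [trueScore, embedding, edgeQuery_add, edgeQuery_sum, edgeQuery_edgeEmbedding,
    Fintype.sum_sum_type, noiseTerm, Sum.elim_inl, Sum.elim_inr]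
  simp [add_assoc]

lemma measurable_noiseTerm (g : QueryGraph V k L) {α : Type*} [MeasurableSpace α]
    {a b : α → UnitSphere d} {y : α → V → UnitSphere d} (ha : Measurable a) (hb : Measurable b)
    (hy : ∀ c, Measurable fun z => y z c) (e : Fin L ⊕ Fin (k - L)) :
    Measurable fun z => g.noiseTerm (a z) (b z) (y z) e := by
  cases e <;> simp only [noiseTerm, Sum.elim_inl, Sum.elim_inr] <;> fun_prop

lemma abs_noiseTerm_le_one (g : QueryGraph V k L) (a b : UnitSphere d) (y : V → UnitSphere d)
    (e : Fin L ⊕ Fin (k - L)) : |g.noiseTerm a b y e| ≤ 1 := by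
  cases e with
  | inl i => exact abs_inner_sphere_le_one _ _
  | inr j =>
    simp only [noiseTerm, Sum.elim_inr, abs_mul]
    exact mul_le_one₀ (abs_inner_sphere_le_one _ _) (abs_nonneg _) (abs_inner_sphere_le_one _ _)

end QueryGraph

/-! ### Bernstein's inequality -/

/-- The exponential series from its quadratic term on is dominated by a geometric series of ratio `l
/ 3`, because `(n + 2)! ≥ 2 * 3 ^ n`. -/
lemma exp_le_one_add_add_sq {y l : ℝ} (hy : |y| ≤ l) (hl : l < 3) :
    Real.exp y ≤ 1 + y + y ^ 2 / (2 * (1 - l / 3)) := by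
  have hl0 : 0 ≤ l := (abs_nonneg y).trans hy
  have h1 : HasSum (fun n : ℕ => y ^ (n + 2) / (n + 2).factorial) (Real.exp y - 1 - y) := by
    have h := NormedSpace.expSeries_div_hasSum_exp (𝔸 := ℝ) y
    rw [← Real.exp_eq_exp_ℝ, ← hasSum_nat_add_iff' 2] at h
    simpa [Finset.sum_range_succ, sub_sub] using h
  have h2 : HasSum (fun n : ℕ => y ^ 2 / 2 * (l / 3) ^ n) (y ^ 2 / 2 * (1 - l / 3)⁻¹) :=
    (hasSum_geometric_of_lt_one (by positivity) (by linarith)).mul_left _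
  have h := hasSum_le (fun n => ?_) h1 h2
  · rw [← div_eq_mul_inv, div_div] at h
    linarith
  · have hf : (2 : ℝ) * 3 ^ n ≤ (n + 2).factorial := by
      have := Nat.factorial_mul_pow_le_factorial (m := 2) (n := n)
      rw [add_comm n 2]
      exact_mod_cast this
    calc y ^ (n + 2) / (n + 2).factorial ≤ |y| ^ (n + 2) / (n + 2).factorial := by
          exact div_le_div_of_nonneg_right ((le_abs_self _).trans (abs_pow y _).le)
            (Nat.cast_nonneg _)
      _ ≤ |y| ^ (n + 2) / (2 * 3 ^ n) := by gcongr
      _ = y ^ 2 / 2 * (|y| / 3) ^ n := by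
          rw [pow_add, sq_abs, div_pow]
          field_simp
      _ ≤ y ^ 2 / 2 * (l / 3) ^ n := by gcongr

section Bernstein

variable {Ω : Type*} [MeasurableSpace Ω] {μ : Measure Ω} [IsProbabilityMeasure μ]

lemma mgf_le_of_abs_le_one {X : Ω → ℝ} (hX : Measurable X) (hb : ∀ ω, |X ω| ≤ 1)
    (h0 : ∫ ω, X ω ∂μ = 0) {t : ℝ} (ht : |t| < 3) :
    mgf X μ t ≤ Real.exp (t ^ 2 * (∫ ω, X ω ^ 2 ∂μ) / (2 * (1 - |t| / 3))) := by
  have hi : Integrable X μ := integrable_of_measurable_of_abs_le hX hb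
  have hi2 : Integrable (fun ω => X ω ^ 2) μ := by
    refine integrable_of_measurable_of_abs_le (by fun_prop) (C := 1) fun ω => ?_
    rw [abs_pow]
    exact pow_le_one₀ (abs_nonneg _) (hb ω)
  have hi1 : Integrable (fun ω => 1 + t * X ω) μ := (integrable_const 1).add (hi.const_mul t)
  have hint : Integrable
      (fun ω => 1 + t * X ω + t ^ 2 / (2 * (1 - |t| / 3)) * X ω ^ 2) μ :=
    hi1.add (hi2.const_mul _)
  calc mgf X μ t
      ≤ ∫ ω, (1 + t * X ω + t ^ 2 / (2 * (1 - |t| / 3)) * X ω ^ 2) ∂μ := by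
        refine integral_mono_of_nonneg (.of_forall fun ω => (Real.exp_pos _).le) hint
          (.of_forall fun ω => ?_)
        have : |t * X ω| ≤ |t| := by
          rw [abs_mul]
          exact mul_le_of_le_one_right (abs_nonneg t) (hb ω)
        refine (exp_le_one_add_add_sq this ht).trans_eq ?_
        ring
    _ = t ^ 2 * (∫ ω, X ω ^ 2 ∂μ) / (2 * (1 - |t| / 3)) + 1 := by
        rw [integral_add hi1 (hi2.const_mul _),
          integral_add (integrable_const 1) (hi.const_mul t), integral_const_mul,
          integral_const_mul, h0]
        simp
        ring
    _ ≤ _ := Real.add_one_le_exp _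

/-- Bernstein's tail bound from the corresponding bound of the moment generating function. -/
lemma measureReal_lt_abs_le_of_mgf_le {S : Ω → ℝ} {v t : ℝ} (hv : 0 < v) (ht : 0 < t)
    (hint : ∀ l, Integrable (fun ω => Real.exp (l * S ω)) μ)
    (hmgf : ∀ l : ℝ, |l| < 3 → mgf S μ l ≤ Real.exp (l ^ 2 * v / (2 * (1 - |l| / 3)))) :
    μ.real {ω | t < |S ω|} ≤ 2 * Real.exp (-(t ^ 2 / (2 * (v + t / 3)))) := by
  have hw : 0 < v + t / 3 := by positivity
  -- Bernstein's choice of parameter: it gives `1 - l / 3 = v / (v + t / 3)`, so the two exponents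
  -- combine to `-t² / (2 (v + t / 3))`.
  set l := t / (v + t / 3) with hl
  have hl0 : 0 < l := by positivity
  have hl3 : |l| < 3 := by
    rw [abs_of_pos hl0, hl, div_lt_iff₀ hw]
    linarith
  have hexp : Real.exp (-l * t) * Real.exp (l ^ 2 * v / (2 * (1 - |l| / 3))) =
      Real.exp (-(t ^ 2 / (2 * (v + t / 3)))) := by
    rw [← Real.exp_add, abs_of_pos hl0]
    have : 1 - l / 3 = v / (v + t / 3) := by
      rw [hl]
      field_simp
      ring
    rw [this, hl]
    congr 1
    field_simp
    ring
  have h1 : μ.real {ω | t ≤ S ω} ≤ Real.exp (-(t ^ 2 / (2 * (v + t / 3)))) := by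
    rw [← hexp]
    refine (measure_ge_le_exp_mul_mgf t hl0.le (hint l)).trans ?_
    gcongr
    exact hmgf l hl3
  have h2 : μ.real {ω | S ω ≤ -t} ≤ Real.exp (-(t ^ 2 / (2 * (v + t / 3)))) := by
    rw [← hexp]
    refine (measure_le_le_exp_mul_mgf (-t) (neg_nonpos.2 hl0.le) (hint (-l))).trans ?_
    rw [neg_neg, mul_neg, ← neg_mul]
    gcongr
    simpa using hmgf (-l) (by simpa using hl3)
  calc μ.real {ω | t < |S ω|} ≤ μ.real ({ω | t ≤ S ω} ∪ {ω | S ω ≤ -t}) := by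
        refine measureReal_mono fun ω hω => ?_
        rcases lt_abs.1 (show t < |S ω| from hω) with h | h
        · exact Or.inl h.le
        · exact Or.inr (show S ω ≤ -t by linarith)
    _ ≤ _ := (measureReal_union_le _ _).trans (by linarith)

end Bernstein

/-! ### Noise terms with the signal codes frozen -/

namespace QueryGraph

variable {Ω V : Type*} [MeasurableSpace Ω] {k L d : ℕ} {x : V → Ω → UnitSphere d} {μ : Measure Ω}

lemma q_ne_r (g : QueryGraph V k L) (j : Fin (k - L)) : g.q j ≠ g.r j := fun h =>
  g.oriented j j (by rw [h])

/-- The second moment of a nuisance term. -/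
def noiseVariance (d : ℕ) : Fin L ⊕ Fin (k - L) → ℝ :=
  Sum.elim (fun _ => 1 / (d : ℝ)) (fun _ => 1 / (d : ℝ) ^ 2)

lemma sum_noiseVariance (g : QueryGraph V k L) :
    ∑ e : Fin L ⊕ Fin (k - L), noiseVariance d e = querySigmaSq d k L := by
  simp [noiseVariance, querySigmaSq, Nat.cast_sub g.L_le]
  ring

lemma integral_noiseTerm_fixed (g : QueryGraph V k L) (h : IsSphericalCode x μ)
    (a b : UnitSphere d) (e : Fin L ⊕ Fin (k - L)) :
    ∫ ω, g.noiseTerm a b (fun c => x c ω) e ∂μ = 0 := by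
  rcases e with i | j
  · exact h.integral_inner _ _
  · have hqr : IndepFun (x (g.q j)) (x (g.r j)) μ := h.indep.indepFun (g.q_ne_r j)
    have hind := hqr.comp
      (φ := fun y : UnitSphere d => inner ℝ (a : Euc d) (y : Euc d)) (ψ := fun y : UnitSphere d => inner ℝ (b : Euc d) (y : Euc d))
      (by fun_prop) (by fun_prop)
    have hm := h.measurable
    have := hind.integral_fun_mul_eq_mul_integral
      (Measurable.aestronglyMeasurable (by fun_prop)) (Measurable.aestronglyMeasurable (by fun_prop))
    refine this.trans ?_
    simp only [Function.comp_apply]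
    rw [h.integral_inner, zero_mul]

lemma integral_noiseTerm_sq_fixed (g : QueryGraph V k L) (h : IsSphericalCode x μ) (hd : 1 ≤ d)
    (a b : UnitSphere d) (e : Fin L ⊕ Fin (k - L)) :
    ∫ ω, g.noiseTerm a b (fun c => x c ω) e ^ 2 ∂μ = noiseVariance d e := by
  rcases e with i | j
  · exact h.integral_inner_sq hd _ _
  · have hqr : IndepFun (x (g.q j)) (x (g.r j)) μ := h.indep.indepFun (g.q_ne_r j)
    have hind := hqr.comp
      (φ := fun y : UnitSphere d => inner ℝ (a : Euc d) (y : Euc d) ^ 2)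
      (ψ := fun y : UnitSphere d => inner ℝ (b : Euc d) (y : Euc d) ^ 2)
      (by fun_prop) (by fun_prop)
    have hm := h.measurable
    have := hind.integral_fun_mul_eq_mul_integral
      (Measurable.aestronglyMeasurable (by fun_prop)) (Measurable.aestronglyMeasurable (by fun_prop))
    simp only [noiseTerm, Sum.elim_inr, mul_pow]
    refine this.trans ?_
    simp only [Function.comp_apply]
    rw [h.integral_inner_sq hd, h.integral_inner_sq hd]
    simp only [noiseVariance, Sum.elim_inr]
    ring

open Classical in
/-- The endpoints of the nuisance edges, except for the source of the signal edge. -/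
def nuisanceVertices (g : QueryGraph V k L) : Finset V :=
  Finset.univ.image (Sum.elim g.p (Sum.elim g.q g.r))

lemma ne_of_mem_nuisanceVertices (g : QueryGraph V k L) {c : V} (hc : c ∈ g.nuisanceVertices) :
    c ≠ g.u ∧ c ≠ g.v := by
  simp only [nuisanceVertices, Finset.mem_image, Finset.mem_univ, true_and] at hc
  obtain ⟨i | j | j, rfl⟩ := hc
  · exact g.p_ne i
  · exact g.q_ne j
  · exact g.r_ne j

-- No nuisance vertex other than the common source `u` is an endpoint of the signal edge, and the
-- factor at `u` is already gone, so the signal codes are independent of everything else the noise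
-- reads. The bound on `Φ` is only asked on the cube where the noise terms live.
open Classical in
lemma integral_noiseTerm_eq_integral_integral (g : QueryGraph V k L) (h : IsSphericalCode x μ)
    {Φ : (Fin L ⊕ Fin (k - L) → ℝ) → ℝ} (hΦ : Measurable Φ) {C : ℝ}
    (hC : ∀ z, (∀ e, |z e| ≤ 1) → |Φ z| ≤ C) :
    ∫ ω, Φ (g.noiseTerm (x g.u ω) (x g.v ω) (fun c => x c ω)) ∂μ =
      ∫ ω, ∫ ω', Φ (g.noiseTerm (x g.u ω) (x g.v ω) (fun c => x c ω')) ∂μ ∂μ := by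
  have := h.indep.isProbabilityMeasure
  have hdisj : Disjoint {g.u, g.v} g.nuisanceVertices := by
    rw [Finset.disjoint_right]
    intro c hc
    simpa using g.ne_of_mem_nuisanceVertices hc
  -- The filler value off the nuisance vertices is never read; taking `a` avoids having to know that
  -- the sphere is nonempty.
  let ext (a : UnitSphere d) (y : g.nuisanceVertices → UnitSphere d) (c : V) : UnitSphere d :=
    if hc : c ∈ g.nuisanceVertices then y ⟨c, hc⟩ else a
  have hext (a b : UnitSphere d) (ω : Ω) :
      g.noiseTerm a b (ext a fun c => x c ω) = g.noiseTerm a b (fun c => x c ω) := by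
    have hp (i) : g.p i ∈ g.nuisanceVertices :=
      Finset.mem_image.2 ⟨.inl i, Finset.mem_univ _, rfl⟩
    have hq (j) : g.q j ∈ g.nuisanceVertices :=
      Finset.mem_image.2 ⟨.inr (.inl j), Finset.mem_univ _, rfl⟩
    have hr (j) : g.r j ∈ g.nuisanceVertices :=
      Finset.mem_image.2 ⟨.inr (.inr j), Finset.mem_univ _, rfl⟩
    funext e
    rcases e with i | j
    · simp [noiseTerm, ext, hp]
    · simp [noiseTerm, ext, hq, hr]
  let G (z : ((({g.u, g.v} : Finset V) → UnitSphere d) × (g.nuisanceVertices → UnitSphere d))) : ℝ :=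
    Φ (g.noiseTerm (z.1 ⟨g.u, by simp⟩) (z.1 ⟨g.v, by simp⟩) (ext (z.1 ⟨g.u, by simp⟩) z.2))
  have hG : Measurable G := by
    refine hΦ.comp (measurable_pi_lambda _ fun e => ?_)
    refine g.measurable_noiseTerm (by fun_prop) (by fun_prop) (fun c => ?_) e
    by_cases hc : c ∈ g.nuisanceVertices
    · simp only [ext, hc, dite_true]
      fun_prop
    · simp only [ext, hc, dite_false]
      fun_prop
  have key := IndepFun.integral_comp_prodMk (h.indep.indepFun_finset _ _ hdisj h.measurable)
    (measurable_pi_lambda _ fun c => h.measurable c)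
    (measurable_pi_lambda _ fun c => h.measurable c) hG
    (fun z => hC _ fun e => g.abs_noiseTerm_le_one _ _ _ e)
  simpa only [G, hext] using key

end QueryGraph

/-! ### Mean, variance and Chebyshev bounds -/

namespace QueryGraph

variable {Ω V : Type*} [MeasurableSpace Ω] {k L d : ℕ} {x : V → Ω → UnitSphere d} {μ : Measure Ω}

/-- The contribution of a nuisance edge to the query score, as a function of the code. -/
def noise (g : QueryGraph V k L) (y : V → UnitSphere d) (e : Fin L ⊕ Fin (k - L)) : ℝ :=
  g.noiseTerm (y g.u) (y g.v) y e

lemma measurable_noise (g : QueryGraph V k L) (e : Fin L ⊕ Fin (k - L)) :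
    Measurable fun y : V → UnitSphere d => g.noise y e :=
  g.measurable_noiseTerm (by fun_prop) (by fun_prop) (by fun_prop) e

lemma abs_noise_le_one (g : QueryGraph V k L) (y : V → UnitSphere d)
    (e : Fin L ⊕ Fin (k - L)) : |g.noise y e| ≤ 1 :=
  g.abs_noiseTerm_le_one _ _ _ e

lemma measurable_noise_comp (g : QueryGraph V k L) (h : IsSphericalCode x μ)
    (e : Fin L ⊕ Fin (k - L)) : Measurable fun ω => g.noise (fun c => x c ω) e :=
  (g.measurable_noise e).comp h.measurable_pi

lemma integral_noise (g : QueryGraph V k L) (h : IsSphericalCode x μ) (e : Fin L ⊕ Fin (k - L)) :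
    ∫ ω, g.noise (fun c => x c ω) e ∂μ = 0 := by
  have := g.integral_noiseTerm_eq_integral_integral h (Φ := fun z => z e) (by fun_prop)
    (C := 1) fun z hz => hz e
  simpa only [noise, g.integral_noiseTerm_fixed h, integral_zero] using this

lemma integral_noise_sq (g : QueryGraph V k L) (h : IsSphericalCode x μ) (hd : 1 ≤ d)
    (e : Fin L ⊕ Fin (k - L)) :
    ∫ ω, g.noise (fun c => x c ω) e ^ 2 ∂μ = noiseVariance d e := by
  have hp := h.indep.isProbabilityMeasure
  have := g.integral_noiseTerm_eq_integral_integral h (Φ := fun z => z e ^ 2) (by fun_prop)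
    (C := 1) fun z hz => by
      rw [abs_pow]
      exact pow_le_one₀ (abs_nonneg _) (hz e)
  simpa only [noise, g.integral_noiseTerm_sq_fixed h hd, integral_const, probReal_univ, one_smul]
    using this

open Classical in
lemma integral_noise_mul_noise (g : QueryGraph V k L) (h : IsSphericalCode x μ)
    {e e' : Fin L ⊕ Fin (k - L)} (he : e ≠ e') :
    ∫ ω, g.noise (fun c => x c ω) e * g.noise (fun c => x c ω) e' ∂μ = 0 := by
  have hodd (a : V) (ha : ∀ y : V → UnitSphere d,
      g.noise (fun b => if b = a then -y b else y b) e *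
        g.noise (fun b => if b = a then -y b else y b) e' = -(g.noise y e * g.noise y e')) :
      ∫ ω, g.noise (fun c => x c ω) e * g.noise (fun c => x c ω) e' ∂μ = 0 :=
    h.integral_eq_zero_of_odd a ((g.measurable_noise e).mul (g.measurable_noise e')) ha
  have huv := g.u_ne_v
  rcases e with i | j <;> rcases e' with i' | j'
  · have hi : g.p i' ≠ g.p i := fun hp => he (by rw [g.p_injective hp])
    refine hodd (g.p i) fun y => ?_
    simp [noise, noiseTerm, hi, (g.p_ne i).2.symm]
  -- In the mixed cases only the `(q, r)` term contains the code of `u`, and it is linear in it.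
  · refine hodd g.u fun y => ?_
    simp [noise, noiseTerm, huv.symm, (g.p_ne i).1, (g.q_ne j').1, (g.r_ne j').1]
  · refine hodd g.u fun y => ?_
    simp [noise, noiseTerm, huv.symm, (g.p_ne i').1, (g.q_ne j).1, (g.r_ne j).1]
  · have hj : j ≠ j' := fun hj => he (by rw [hj])
    have hedge : ¬(g.q j = g.q j' ∧ g.r j = g.r j') := fun hqr =>
      hj (g.edge_injective (Prod.ext hqr.1 hqr.2))
    have hrev : ¬(g.q j = g.r j' ∧ g.r j = g.q j') := fun hqr =>
      g.oriented j j' (Prod.ext hqr.1 hqr.2)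
    have hl := g.q_ne_r j
    have hl' := g.q_ne_r j'
    have key (a : V) (hu : g.u ≠ a) (hv : g.v ≠ a)
        (h1 : (g.q j = a ∧ g.r j ≠ a ∧ g.q j' ≠ a ∧ g.r j' ≠ a) ∨
          (g.q j ≠ a ∧ g.r j = a ∧ g.q j' ≠ a ∧ g.r j' ≠ a) ∨
          (g.q j ≠ a ∧ g.r j ≠ a ∧ g.q j' = a ∧ g.r j' ≠ a)) :
        ∫ ω, g.noise (fun c => x c ω) (.inr j) * g.noise (fun c => x c ω) (.inr j') ∂μ = 0 := by
      refine hodd a fun y => ?_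
      rcases h1 with ⟨h1, h2, h3, h4⟩ | ⟨h1, h2, h3, h4⟩ | ⟨h1, h2, h3, h4⟩ <;>
        simp only [noise, noiseTerm, Sum.elim_inr, hu, hv, h1, h2, h3, h4, if_true, if_false,
          coe_neg_sphere, inner_neg_right] <;> ring
    -- The two edges differ even as unordered pairs and neither is a loop, so some vertex is an
    -- endpoint of exactly one of them; its code is the one to negate.
    by_cases h1 : g.q j = g.q j'
    · exact key (g.r j) (g.r_ne j).1.symm (g.r_ne j).2.symm
        (Or.inr (Or.inl ⟨hl, rfl, fun h' => hl (h1.trans h'), fun h' => hedge ⟨h1, h'.symm⟩⟩))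
    · by_cases h2 : g.q j = g.r j'
      · exact key (g.q j') (g.q_ne j').1.symm (g.q_ne j').2.symm
          (Or.inr (Or.inr ⟨h1, fun h' => hrev ⟨h2, h'⟩, rfl, hl'.symm⟩))
      · exact key (g.q j) (g.q_ne j).1.symm (g.q_ne j).2.symm
          (Or.inl ⟨rfl, hl.symm, Ne.symm h1, Ne.symm h2⟩)

lemma trueScore_eq_one_add (g : QueryGraph V k L) {Ω : Type*} (x : V → Ω → UnitSphere d) :
    g.trueScore x = fun ω => 1 + ∑ e, g.noise (fun c => x c ω) e :=
  funext fun ω => g.trueScore_eq x ω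

lemma measurable_trueScore (g : QueryGraph V k L) (h : IsSphericalCode x μ) :
    Measurable (g.trueScore x) := by
  rw [trueScore_eq_one_add]
  exact (Finset.measurable_sum _ fun e _ => g.measurable_noise_comp h e).const_add 1

lemma abs_trueScore_sub_one_le (g : QueryGraph V k L) {Ω : Type*} (x : V → Ω → UnitSphere d) (ω : Ω) :
    |g.trueScore x ω - 1| ≤ k := by
  rw [trueScore_eq_one_add, add_sub_cancel_left]
  refine (Finset.abs_sum_le_sum_abs _ _).trans
    ((Finset.sum_le_sum fun e _ => g.abs_noise_le_one _ e).trans_eq ?_)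
  simp [Nat.cast_sub g.L_le]

lemma memLp_trueScore (g : QueryGraph V k L) (h : IsSphericalCode x μ) :
    MemLp (g.trueScore x) 2 μ := by
  have := h.indep.isProbabilityMeasure
  refine MemLp.of_bound (g.measurable_trueScore h).aestronglyMeasurable (k + 1)
    (.of_forall fun ω => ?_)
  have h1 := abs_add_le (g.trueScore x ω - 1) 1
  have h2 := g.abs_trueScore_sub_one_le x ω
  rw [sub_add_cancel, abs_one] at h1
  rw [Real.norm_eq_abs]
  linarith

lemma integral_trueScore (g : QueryGraph V k L) (h : IsSphericalCode x μ) :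
    μ[g.trueScore x] = 1 := by
  have := h.indep.isProbabilityMeasure
  have hint (e) : Integrable (fun ω => g.noise (fun c => x c ω) e) μ :=
    integrable_of_measurable_of_abs_le (g.measurable_noise_comp h e) fun ω => g.abs_noise_le_one _ e
  rw [trueScore_eq_one_add, integral_add (integrable_const 1) (integrable_finsetSum _ fun e _ => hint e),
    integral_finsetSum _ fun e _ => hint e]
  simp [g.integral_noise h]

lemma variance_trueScore (g : QueryGraph V k L) (h : IsSphericalCode x μ) (hd : 1 ≤ d) :
    Var[g.trueScore x; μ] = querySigmaSq d k L := by
  have := h.indep.isProbabilityMeasure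
  have hint (e e') : Integrable
      (fun ω => g.noise (fun c => x c ω) e * g.noise (fun c => x c ω) e') μ := by
    refine integrable_of_measurable_of_abs_le
      ((g.measurable_noise_comp h e).mul (g.measurable_noise_comp h e')) (C := 1) fun ω => ?_
    rw [abs_mul]
    exact mul_le_one₀ (g.abs_noise_le_one _ e) (abs_nonneg _) (g.abs_noise_le_one _ e')
  rw [variance_eq_integral (g.measurable_trueScore h).aemeasurable, g.integral_trueScore h]
  simp only [trueScore_eq_one_add, add_sub_cancel_left, pow_two, Finset.sum_mul_sum]
  rw [integral_finsetSum _ fun e _ => integrable_finsetSum _ fun e' _ => hint e e',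
    ← g.sum_noiseVariance]
  refine Finset.sum_congr rfl fun e _ => ?_
  rw [integral_finsetSum _ fun e' _ => hint e e', Finset.sum_eq_single e]
  · simpa only [pow_two] using g.integral_noise_sq h hd e
  · exact fun e' _ he => g.integral_noise_mul_noise h he.symm
  · simp

lemma querySigmaSq_nonneg (g : QueryGraph V k L) : 0 ≤ querySigmaSq d k L := by
  have : (L : ℝ) ≤ k := by exact_mod_cast g.L_le
  have : 0 ≤ (k : ℝ) - L := by linarith
  unfold querySigmaSq
  positivity

lemma querySigma_sq (g : QueryGraph V k L) : querySigma d k L ^ 2 = querySigmaSq d k L :=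
  Real.sq_sqrt g.querySigmaSq_nonneg

/-- Chebyshev with a free radius `c`, serving both `C σ` and `C √k / d`. -/
lemma measureReal_abs_trueScore_sub_one_le (g : QueryGraph V k L) (h : IsSphericalCode x μ)
    (hd : 1 ≤ d) {δ c : ℝ} (hδ : 0 < δ) (hc0 : 0 ≤ c) (hc : querySigmaSq d k L ≤ δ * c ^ 2) :
    1 - δ ≤ μ.real {ω | |g.trueScore x ω - 1| ≤ c} := by
  have := h.indep.isProbabilityMeasure
  have hm := g.measurable_trueScore h
  -- Chebyshev divides by `c²`. For `c = 0` the variance vanishes and the score is almost surely its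
  -- mean.
  rcases hc0.eq_or_lt with rfl | hc0
  · have hvar : Var[g.trueScore x; μ] = 0 := by
      rw [g.variance_trueScore h hd]
      exact le_antisymm (by simpa using hc) g.querySigmaSq_nonneg
    have hae : ∀ᵐ ω ∂μ, g.trueScore x ω = 1 := by
      have hev : eVar[g.trueScore x; μ] = 0 := by
        rw [← (g.memLp_trueScore h).ofReal_variance_eq, hvar, ENNReal.ofReal_zero]
      have := (evariance_eq_zero_iff hm.aemeasurable).1 hev
      rwa [g.integral_trueScore h] at this
    have : μ {ω | |g.trueScore x ω - 1| ≤ 0} = 1 := by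
      refine (mem_ae_iff_prob_eq_one (measurableSet_le (by fun_prop) measurable_const)).1 ?_
      filter_upwards [hae] with ω hω
      simp [hω]
    simp only [Measure.real, this, ENNReal.toReal_one]
    linarith
  · have hcheb := meas_ge_le_variance_div_sq (g.memLp_trueScore h) hc0
    rw [g.integral_trueScore h, g.variance_trueScore h hd] at hcheb
    have hle : μ.real {ω | c ≤ |g.trueScore x ω - 1|} ≤ δ := by
      refine (ENNReal.toReal_mono ENNReal.ofReal_ne_top hcheb).trans ?_
      rw [ENNReal.toReal_ofReal (div_nonneg g.querySigmaSq_nonneg (sq_nonneg c)),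
        div_le_iff₀ (by positivity)]
      exact hc
    have huniv : (1 : ℝ) ≤ μ.real {ω | |g.trueScore x ω - 1| ≤ c} +
        μ.real {ω | c ≤ |g.trueScore x ω - 1|} := by
      refine (probReal_univ (μ := μ)).symm.trans_le ?_
      refine (measureReal_mono fun ω _ => ?_).trans (measureReal_union_le _ _)
      exact le_total (|g.trueScore x ω - 1|) c
    linarith

/-! ### Exponential tail for distinct vertices -/

lemma iIndepFun_noiseTerm_fixed (g : QueryGraph V k L) (h : IsSphericalCode x μ)
    (hg : g.VerticesDistinct) (a b : UnitSphere d) :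
    iIndepFun (fun e ω => g.noiseTerm a b (fun c => x c ω) e) μ := by
  -- `π` sends an endpoint to its nuisance edge; the fibres are the disjoint blocks `{p_i}` and
  -- `{q_j, r_j}`, and each noise term is a function of one block.
  let π : Fin L ⊕ (Fin (k - L) ⊕ Fin (k - L)) → Fin L ⊕ Fin (k - L) :=
    Sum.map id (Sum.elim id id)
  have h1 := h.indep.precomp hg
  have h2 := h1.precomp (Equiv.sigmaFiberEquiv π).injective
  have h3 := iIndepFun_curry (κ := fun e => {s // π s = e})
    (X := fun e s => x (Sum.elim g.p (Sum.elim g.q g.r) s.1)) (fun _ _ => h.measurable _) h2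
  let φ (e : Fin L ⊕ Fin (k - L)) (z : {s // π s = e} → UnitSphere d) : ℝ :=
    match e, z with
    | .inl i, z => inner ℝ (b : Euc d) (z ⟨.inl i, rfl⟩ : Euc d)
    | .inr j, z => inner ℝ (a : Euc d) (z ⟨.inr (.inl j), rfl⟩ : Euc d) *
        inner ℝ (b : Euc d) (z ⟨.inr (.inr j), rfl⟩ : Euc d)
  have h4 := h3.comp φ fun e => by
    cases e <;> simp only [φ] <;> fun_prop
  convert! h4 using 2 with e
  cases e <;> rfl

lemma mgf_sum_noise_le (g : QueryGraph V k L) (h : IsSphericalCode x μ) (hd : 1 ≤ d)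
    (hg : g.VerticesDistinct) {t : ℝ} (ht : |t| < 3) :
    mgf (fun ω => ∑ e, g.noise (fun c => x c ω) e) μ t ≤
      Real.exp (t ^ 2 * querySigmaSq d k L / (2 * (1 - |t| / 3))) := by
  have := h.indep.isProbabilityMeasure
  have hm (a b : UnitSphere d) (e) : Measurable fun ω => g.noiseTerm a b (fun c => x c ω) e :=
    g.measurable_noiseTerm measurable_const measurable_const h.measurable e
  have hfixed (a b : UnitSphere d) :
      ∫ ω, Real.exp (t * ∑ e, g.noiseTerm a b (fun c => x c ω) e) ∂μ ≤
        Real.exp (t ^ 2 * querySigmaSq d k L / (2 * (1 - |t| / 3))) := by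
    have hprod := (g.iIndepFun_noiseTerm_fixed h hg a b).mgf_sum (t := t) (hm a b) Finset.univ
    have heq : mgf (∑ e, fun ω => g.noiseTerm a b (fun c => x c ω) e) μ t =
        ∫ ω, Real.exp (t * ∑ e, g.noiseTerm a b (fun c => x c ω) e) ∂μ := by
      simp [mgf]
    rw [← heq, hprod, ← g.sum_noiseVariance, Finset.mul_sum, Finset.sum_div, Real.exp_sum]
    refine Finset.prod_le_prod (fun e _ => mgf_nonneg) fun e _ => ?_
    rw [← g.integral_noiseTerm_sq_fixed h hd a b e]
    exact mgf_le_of_abs_le_one (hm a b e) (fun ω => g.abs_noiseTerm_le_one a b _ e)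
      (g.integral_noiseTerm_fixed h a b e) ht
  -- This crude bound only provides the integrability needed to freeze `u` and `v`.
  have hbound (z : Fin L ⊕ Fin (k - L) → ℝ) (hz : ∀ e, |z e| ≤ 1) :
      |Real.exp (t * ∑ e, z e)| ≤ Real.exp (|t| * k) := by
    rw [abs_of_pos (Real.exp_pos _), Real.exp_le_exp]
    refine (le_abs_self _).trans ?_
    rw [abs_mul]
    gcongr
    refine (Finset.abs_sum_le_sum_abs _ _).trans ((Finset.sum_le_sum fun e _ => hz e).trans_eq ?_)
    simp [Nat.cast_sub g.L_le]
  refine (g.integral_noiseTerm_eq_integral_integral h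
    (Φ := fun z => Real.exp (t * ∑ e, z e)) (by fun_prop) hbound).trans_le ?_
  refine (integral_mono_of_nonneg (.of_forall fun ω => integral_nonneg fun _ => (Real.exp_pos _).le)
    (integrable_const _) (.of_forall fun ω => hfixed _ _)).trans_eq ?_
  simp

lemma measureReal_lt_abs_trueScore_sub_one_le (g : QueryGraph V k L) (h : IsSphericalCode x μ)
    (hd : 1 ≤ d) (hg : g.VerticesDistinct) {C : ℝ} (hC : 0 < C) :
    μ.real {ω | C * querySigma d k L < |g.trueScore x ω - 1|} ≤
      2 * Real.exp (-(C ^ 2 * querySigma d k L ^ 2 /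
        (2 * (querySigma d k L ^ 2 + C * querySigma d k L / 3)))) := by
  have := h.indep.isProbabilityMeasure
  rcases (Real.sqrt_nonneg (querySigmaSq d k L)).eq_or_lt with h0 | h0
  -- For `σ = 0` the exponent is `0 / 0 = 0`, so the bound is `2` and holds trivially.
  · have hs : querySigma d k L = 0 := h0.symm
    simp only [hs]
    refine measureReal_le_one.trans ?_
    norm_num
  · have hs : 0 < querySigma d k L := h0
    have hsum (ω : Ω) : g.trueScore x ω - 1 = ∑ e, g.noise (fun c => x c ω) e := by
      rw [trueScore_eq_one_add, add_sub_cancel_left]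
    have hmeas : Measurable fun ω => g.trueScore x ω - 1 := (g.measurable_trueScore h).sub_const 1
    rw [← mul_pow]
    refine measureReal_lt_abs_le_of_mgf_le (S := fun ω => g.trueScore x ω - 1)
      (v := querySigma d k L ^ 2) (t := C * querySigma d k L) (by positivity) (by positivity)
      (fun l => ?_) fun l hl => ?_
    · refine integrable_of_measurable_of_abs_le (by fun_prop) (C := Real.exp (|l| * k)) fun ω => ?_
      rw [abs_of_pos (Real.exp_pos _), Real.exp_le_exp]
      refine (le_abs_self _).trans ?_
      rw [abs_mul]
      gcongr
      exact g.abs_trueScore_sub_one_le x ω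
    · simp only [hsum, g.querySigma_sq]
      exact g.mgf_sum_noise_le h hd hg hl

lemma querySigmaSq_le (hd : 1 ≤ d) {A : ℝ} (h : (d : ℝ) * L ≤ A * k) :
    querySigmaSq d k L ≤ (A + 1) * (√(k : ℝ) / d) ^ 2 := by
  have hd' : (0 : ℝ) < d := by exact_mod_cast hd
  rw [div_pow, Real.sq_sqrt (Nat.cast_nonneg k), querySigmaSq, ← mul_div_assoc,
    le_div_iff₀ (by positivity)]
  have : ((L : ℝ) / d + ((k : ℝ) - L) / (d : ℝ) ^ 2) * (d : ℝ) ^ 2 = d * L + (k - L) := by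
    field_simp
  rw [this]
  have : (0 : ℝ) ≤ L := Nat.cast_nonneg L
  linarith

end QueryGraph

end

theorem mainTheorem7 :
    -- mean and variance
    (∀ (d k L : ℕ) (V Ω : Type*) [MeasurableSpace Ω] (μ : Measure Ω) [IsProbabilityMeasure μ]
        (g : QueryGraph V k L) (x : V → Ω → UnitSphere d),
        1 ≤ d → IsSphericalCode x μ →
          MemLp (g.trueScore x) 2 μ ∧
          μ[g.trueScore x] = 1 ∧
          Var[g.trueScore x; μ] = querySigmaSq d k L) ∧
    -- deviations of order `σ` with high probability, the constant depending only on `δ`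
    (∀ δ : ℝ, 0 < δ → ∃ C : ℝ, 0 < C ∧
      ∀ (d k L : ℕ) (V Ω : Type*) [MeasurableSpace Ω] (μ : Measure Ω) [IsProbabilityMeasure μ]
        (g : QueryGraph V k L) (x : V → Ω → UnitSphere d),
        1 ≤ d → IsSphericalCode x μ →
          1 - δ ≤ μ.real {ω | |g.trueScore x ω - 1| ≤ C * querySigma d k L}) ∧
    -- exponential tail when all vertices are distinct
    (∀ (d k L : ℕ) (V Ω : Type*) [MeasurableSpace Ω] (μ : Measure Ω) [IsProbabilityMeasure μ]
        (g : QueryGraph V k L) (x : V → Ω → UnitSphere d),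
        1 ≤ d → IsSphericalCode x μ → g.VerticesDistinct →
          ∀ C : ℝ, 0 < C →
            μ.real {ω | C * querySigma d k L < |g.trueScore x ω - 1|} ≤
              2 * Real.exp (-(C ^ 2 * querySigma d k L ^ 2 /
                (2 * (querySigma d k L ^ 2 + C * querySigma d k L / 3))))) ∧
    -- deviations of order `√k / d` when `k` is large compared with `L`
    (∀ A δ : ℝ, 0 < A → 0 < δ → ∃ C : ℝ, 0 < C ∧
      ∀ (d k L : ℕ) (V Ω : Type*) [MeasurableSpace Ω] (μ : Measure Ω) [IsProbabilityMeasure μ]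
        (g : QueryGraph V k L) (x : V → Ω → UnitSphere d),
        1 ≤ d → IsSphericalCode x μ → (d : ℝ) * L ≤ A * k →
          1 - δ ≤ μ.real {ω | |g.trueScore x ω - 1| ≤ C * (√(k : ℝ) / d)}) := by
  -- The constants `√(1 / δ)` and `√((A + 1) / δ)` solve `δ C² = 1` and `δ C² = A + 1`, exactly what
  -- Chebyshev needs given `σ² ≤ (A + 1) k / d²` in the second case.
  refine ⟨fun d k L V Ω _ μ _ g x hd h => ⟨g.memLp_trueScore h, g.integral_trueScore h,
    g.variance_trueScore h hd⟩, fun δ hδ => ⟨√(1 / δ), by positivity,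
    fun d k L V Ω _ μ _ g x hd h => ?_⟩, fun d k L V Ω _ μ _ g x hd h hg C hC =>
    g.measureReal_lt_abs_trueScore_sub_one_le h hd hg hC, fun A δ hA hδ =>
    ⟨√((A + 1) / δ), by positivity, fun d k L V Ω _ μ _ g x hd h hk => ?_⟩⟩
  · refine g.measureReal_abs_trueScore_sub_one_le h hd hδ
      (mul_nonneg (Real.sqrt_nonneg _) (Real.sqrt_nonneg _)) (le_of_eq ?_)
    rw [mul_pow, g.querySigma_sq, Real.sq_sqrt (by positivity)]
    field_simp
  · refine g.measureReal_abs_trueScore_sub_one_le h hd hδ (by positivity)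
      ((QueryGraph.querySigmaSq_le hd hk).trans_eq ?_)
    rw [mul_pow, Real.sq_sqrt (by positivity)]
    field_simp
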